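/- Let $\mu$ be a finite Borel measure on $\mathbb{C}$ whose support is compact and infinite. Let $\varphi_n$ ($n\ge 0$) be its orthonormal polynomials, obtained by Gram–Schmidt from $1,z,z^2,\dots$ in $L^2(\mu)$, with $\varphi_n$ of degree $n$ and leading coefficient $\kappa_n>0$. Let $M$ be the Bergman shift matrix, that is, the matrix of the operator $f(z)\mapsto zf(z)$ on the closure $\mathcal{P}$ of the polynomials in $L^2(\mu)$ with respect to the orthonormal basis $\{\varphi_n\}_{n\ge0}$ of $\mathcal{P}$, regarded as a bounded operator on $\ell^2(\mathbb{N})$. Let $\mathcal{R}$ and $\mathcal{L}$ be the right and the left shift on $\ell^2(\mathbb{N})$. Assume that \[ \liminf_{n\to\infty}\frac{\kappa_n}{\kappa_{n+1}}>0 . \] Then the following are equivalent: (a) There exist a real number $R>0$ and a function $f$ analytic in $\{z: R<|z|\le\infty\}$ (the point $\infty$ of the Riemann sphere included) such that \[ \lim_{n\to\infty}\frac{\varphi_n(z)}{\varphi_{n+1}(z)}=f(z)\qquad\text{for every } z \text{ with } R<|z|\le\infty . \] (b) $M$ is weakly asymptotically Toeplitz: there is a bounded Toeplitz operator $T$ on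 $\ell^2(\mathbb{N})$ (one whose matrix entries $T_{i,j}$ depend only on $j-i$) such that $\mathcal{L}^nM\mathcal{R}^n$ converges to $T$ in the weak operator topology as $n\to\infty$. -/

import Mathlib

open MeasureTheory Filter Topology Polynomial
open scoped ENNReal ComplexConjugate InnerProductSpace

noncomputable section

namespace OrthPoly

/-! ### Orthogonal polynomials of a measure on the plane -/

/-- The monic orthogonal polynomials `Φ_n` of `μ`: Gram-Schmidt orthogonalization of
`1, z, z², …` with respect to the inner product of `L²(μ)`. -/
def monicPoly (μ : Measure ℂ) (n : ℕ) : ℂ[X] :=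
  X ^ n - ∑ k : Fin n,
    C ((∫ z, conj ((monicPoly μ k).eval z) * z ^ n ∂μ) /
      (∫ z, ‖(monicPoly μ k).eval z‖ ^ 2 ∂μ : ℝ)) * monicPoly μ k
termination_by n
decreasing_by all_goals exact k.2

/-- `κ_n = 1 / ‖Φ_n‖`, the norm being that of `L²(μ)`; it is the leading coefficient of `φ_n`. -/
def kappa (μ : Measure ℂ) (n : ℕ) : ℝ :=
  (√(∫ z, ‖(monicPoly μ n).eval z‖ ^ 2 ∂μ))⁻¹

/-- The orthonormal polynomials `φ_n = κ_n Φ_n` of `μ`. -/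
def orthoPoly (μ : Measure ℂ) (n : ℕ) : ℂ[X] :=
  C (kappa μ n : ℂ) * monicPoly μ n

lemma monicPoly_eq (μ : Measure ℂ) (n : ℕ) :
    monicPoly μ n = X ^ n - ∑ k ∈ Finset.Iio n,
      C ((∫ z, conj ((monicPoly μ k).eval z) * z ^ n ∂μ) /
        (∫ z, ‖(monicPoly μ k).eval z‖ ^ 2 ∂μ : ℝ)) * monicPoly μ k := by
  rw [monicPoly]
  congr 1
  rw [Nat.Iio_eq_range]
  exact Fin.sum_univ_eq_sum_range (fun k : ℕ =>
      C ((∫ z, conj ((monicPoly μ k).eval z) * z ^ n ∂μ) /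
        (∫ z, ‖(monicPoly μ k).eval z‖ ^ 2 ∂μ : ℝ)) * monicPoly μ k) n

lemma monic_monicPoly (μ : Measure ℂ) (n : ℕ) :
    (monicPoly μ n).Monic ∧ (monicPoly μ n).natDegree = n := by
  induction n using Nat.strong_induction_on with
  | _ n ih =>
    have hlt : (∑ k ∈ Finset.Iio n,
        C ((∫ z, conj ((monicPoly μ k).eval z) * z ^ n ∂μ) /
          (∫ z, ‖(monicPoly μ k).eval z‖ ^ 2 ∂μ : ℝ)) * monicPoly μ k).degree
        < ((n : ℕ) : WithBot ℕ) := by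
      refine lt_of_le_of_lt (degree_sum_le _ _) ((Finset.sup_lt_iff (WithBot.bot_lt_coe n)).2 ?_)
      intro k hk
      have hk' : k < n := Finset.mem_Iio.1 hk
      refine lt_of_le_of_lt degree_le_natDegree ?_
      refine lt_of_le_of_lt (Nat.cast_le.2 (natDegree_C_mul_le _ _)) ?_
      rw [(ih k hk').2]
      exact Nat.cast_lt.2 hk'
    rw [monicPoly_eq]
    refine ⟨monic_X_pow_sub hlt, ?_⟩
    rw [← degree_X_pow (R := ℂ) n] at hlt
    apply natDegree_eq_of_degree_eq_some
    rw [degree_sub_eq_left_of_degree_lt hlt, degree_X_pow]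

/-- `κ_n` is the leading coefficient of `φ_n`. -/
lemma leadingCoeff_orthoPoly (μ : Measure ℂ) (n : ℕ) :
    (orthoPoly μ n).leadingCoeff = kappa μ n := by
  rw [orthoPoly, leadingCoeff_mul, (monic_monicPoly μ n).1, leadingCoeff_C, mul_one]

/-! ### The Bergman shift -/

section Shift

variable {μ : Measure ℂ} [IsFiniteMeasure μ]

lemma memLp_of_continuous (hc : IsCompact μ.support) {g : ℂ → ℂ} (hg : Continuous g) (p : ℝ≥0∞) :
    MemLp g p μ := by
  obtain ⟨B, hB⟩ := hc.exists_bound_of_continuousOn hg.continuousOn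
  refine MemLp.of_bound hg.aestronglyMeasurable B ?_
  filter_upwards [Measure.support_mem_ae (μ := μ)] with x hx using hB x hx

/-- The class of a polynomial in `L²(μ)`. -/
def polyLp (hc : IsCompact μ.support) : ℂ[X] →ₗ[ℂ] Lp ℂ 2 μ where
  toFun p := (memLp_of_continuous hc p.continuous 2).toLp (fun z => p.eval z)
  map_add' p q := by
    rw [← MemLp.toLp_add]
    exact MemLp.toLp_congr _ _ (ae_of_all _ fun z => by simp)
  map_smul' c p := by
    rw [RingHom.id_apply, ← MemLp.toLp_const_smul]
    exact MemLp.toLp_congr _ _ (ae_of_all _ fun z => by simp)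

lemma coeFn_polyLp (hc : IsCompact μ.support) (p : ℂ[X]) :
    polyLp hc p =ᵐ[μ] fun z => p.eval z :=
  MemLp.coeFn_toLp (memLp_of_continuous hc p.continuous 2)

/-- `𝒫`: the closure of the polynomials in `L²(μ)`. -/
def polySpace (hc : IsCompact μ.support) : Submodule ℂ (Lp ℂ 2 μ) :=
  (LinearMap.range (polyLp hc)).topologicalClosure

/-- Multiplication by `z` on `L²(μ)`. -/
def mulZ (hc : IsCompact μ.support) : Lp ℂ 2 μ →L[ℂ] Lp ℂ 2 μ :=
  (ContinuousLinearMap.mul ℂ ℂ).holderL μ ∞ 2 2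
    ((memLp_of_continuous hc continuous_id ∞).toLp (fun z : ℂ => z))

lemma coeFn_mulZ (hc : IsCompact μ.support) (f : Lp ℂ 2 μ) :
    mulZ hc f =ᵐ[μ] fun z => z * f z := by
  have h1 := (ContinuousLinearMap.mul ℂ ℂ).coeFn_holder (r := 2)
    ((memLp_of_continuous hc continuous_id ∞).toLp (fun z : ℂ => z)) f
  have h2 := MemLp.coeFn_toLp (memLp_of_continuous hc continuous_id ∞)
  filter_upwards [h1, h2] with z hz1 hz2
  refine hz1.trans ?_
  rw [ContinuousLinearMap.mul_apply']
  exact congrArg (· * f z) hz2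

lemma mulZ_polyLp (hc : IsCompact μ.support) (p : ℂ[X]) :
    mulZ hc (polyLp hc p) = polyLp hc (X * p) := by
  apply Lp.ext
  filter_upwards [coeFn_mulZ hc (polyLp hc p), coeFn_polyLp hc p, coeFn_polyLp hc (X * p)]
    with z h1 h2 h3
  rw [h1, h2, h3, eval_mul, eval_X]

lemma mulZ_mem (hc : IsCompact μ.support) (f : Lp ℂ 2 μ) (hf : f ∈ polySpace hc) :
    mulZ hc f ∈ polySpace hc := by
  have hsub : Set.MapsTo (mulZ hc) (LinearMap.range (polyLp hc) : Set (Lp ℂ 2 μ))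
      (LinearMap.range (polyLp hc)) := by
    rintro _ ⟨p, rfl⟩
    exact ⟨X * p, (mulZ_polyLp hc p).symm⟩
  exact hsub.closure (mulZ hc).continuous hf

/-- The restriction of multiplication by `z` to `𝒫`. -/
def mulZRestrict (hc : IsCompact μ.support) : polySpace hc →L[ℂ] polySpace hc :=
  (mulZ hc ∘L (polySpace hc).subtypeL).codRestrict (polySpace hc)
    fun f => mulZ_mem hc f f.2

lemma inner_polyLp (hc : IsCompact μ.support) (p q : ℂ[X]) :
    ⟪polyLp hc p, polyLp hc q⟫_ℂ = ∫ z, conj (p.eval z) * q.eval z ∂μ := by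
  rw [L2.inner_def]
  apply integral_congr_ae
  filter_upwards [coeFn_polyLp hc p, coeFn_polyLp hc q] with z h1 h2
  rw [h1, h2, RCLike.inner_apply, mul_comm]

lemma norm_sq_polyLp (hc : IsCompact μ.support) (p : ℂ[X]) :
    ‖polyLp hc p‖ ^ 2 = ∫ z, ‖p.eval z‖ ^ 2 ∂μ := by
  have h := inner_polyLp hc p p
  rw [inner_self_eq_norm_sq_to_K] at h
  have h2 : (∫ z, conj (p.eval z) * p.eval z ∂μ) = ((∫ z, ‖p.eval z‖ ^ 2 ∂μ : ℝ) : ℂ) := by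
    rw [← integral_complex_ofReal]
    congr 1
    ext z
    rw [mul_comm, Complex.mul_conj, Complex.normSq_eq_norm_sq]
  rw [h2] at h
  apply Complex.ofReal_injective
  rw [← h]
  push_cast
  rfl

lemma polyLp_injective (hc : IsCompact μ.support) (hinf : μ.support.Infinite) :
    Function.Injective (polyLp hc) := by
  rw [injective_iff_map_eq_zero]
  intro p hp
  by_contra hne
  apply hinf
  refine (p.rootSet_finite ℂ).subset ?_
  intro z hz
  rw [mem_rootSet_of_ne hne, coe_aeval_eq_eval]
  by_contra hpz
  have hae : ∀ᵐ w ∂μ, p.eval w = 0 := by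
    have h1 := coeFn_polyLp hc p
    rw [hp] at h1
    filter_upwards [h1, Lp.coeFn_zero ℂ 2 μ] with w h2 h3
    rw [← h2, h3]; rfl
  have hU : {w | p.eval w ≠ 0} ∈ 𝓝 z :=
    (isOpen_ne_fun p.continuous continuous_const).mem_nhds hpz
  exact ((Measure.mem_support_iff_forall z).1 hz _ hU).ne' hae

lemma polyLp_monicPoly (hc : IsCompact μ.support) (n : ℕ) :
    polyLp hc (monicPoly μ n)
      = InnerProductSpace.gramSchmidt ℂ (fun k : ℕ => polyLp hc (X ^ k)) n := by
  induction n using Nat.strong_induction_on with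
  | _ n ih =>
    have h := InnerProductSpace.gramSchmidt_def'' ℂ (fun k : ℕ => polyLp hc (X ^ k)) n
    rw [← sub_eq_iff_eq_add] at h
    rw [← h, monicPoly_eq, map_sub, map_sum]
    congr 1
    refine Finset.sum_congr rfl fun k hk => ?_
    rw [← ih k (Finset.mem_Iio.1 hk), C_mul', map_smul, inner_polyLp, ← norm_sq_polyLp hc]
    simp

lemma polyLp_orthoPoly (hc : IsCompact μ.support) (n : ℕ) :
    polyLp hc (orthoPoly μ n)
      = InnerProductSpace.gramSchmidtNormed ℂ (fun k : ℕ => polyLp hc (X ^ k)) n := by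
  rw [InnerProductSpace.gramSchmidtNormed, ← polyLp_monicPoly hc, orthoPoly, C_mul', map_smul,
    kappa, ← norm_sq_polyLp hc, Real.sqrt_sq (norm_nonneg _)]
  simp

lemma orthonormal_orthoPoly (hc : IsCompact μ.support) (hinf : μ.support.Infinite) :
    Orthonormal ℂ fun n => polyLp hc (orthoPoly μ n) := by
  simp_rw [polyLp_orthoPoly hc]
  apply InnerProductSpace.gramSchmidtNormed_orthonormal
  have h : LinearIndependent ℂ (polyLp hc ∘ basisMonomials ℂ) :=
    (basisMonomials ℂ).linearIndependent.map' (polyLp hc)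
      (LinearMap.ker_eq_bot.2 (polyLp_injective hc hinf))
  have he : (polyLp hc ∘ basisMonomials ℂ) = fun k : ℕ => polyLp hc (X ^ k) := by
    ext1 k
    simp [X_pow_eq_monomial]
  rwa [he] at h

lemma span_orthoPoly (hc : IsCompact μ.support) :
    Submodule.span ℂ (Set.range fun n => polyLp hc (orthoPoly μ n))
      = LinearMap.range (polyLp hc) := by
  simp_rw [polyLp_orthoPoly hc]
  rw [InnerProductSpace.span_gramSchmidtNormed_range, InnerProductSpace.span_gramSchmidt,
    LinearMap.range_eq_map, ← (basisMonomials ℂ).span_eq, Submodule.map_span, ← Set.range_comp]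
  congr 2
  ext k
  simp [X_pow_eq_monomial]

/-- `φ_n` as an element of `𝒫`. -/
def orthoVec (hc : IsCompact μ.support) (n : ℕ) : polySpace hc :=
  ⟨polyLp hc (orthoPoly μ n), Submodule.le_topologicalClosure _ ⟨_, rfl⟩⟩

lemma orthonormal_orthoVec (hc : IsCompact μ.support) (hinf : μ.support.Infinite) :
    Orthonormal ℂ (orthoVec hc) :=
  (orthonormal_orthoPoly hc hinf).codRestrict (polySpace hc) fun n => (orthoVec hc n).2

lemma dense_orthoVec (hc : IsCompact μ.support) :
    ⊤ ≤ (Submodule.span ℂ (Set.range (orthoVec hc))).topologicalClosure := by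
  intro f _
  change f ∈ closure ((Submodule.span ℂ (Set.range (orthoVec hc)) : Submodule ℂ (polySpace hc)) :
    Set (polySpace hc))
  rw [closure_subtype]
  have h : (Subtype.val '' ((Submodule.span ℂ (Set.range (orthoVec hc)) :
      Submodule ℂ (polySpace hc)) : Set (polySpace hc)))
      = (LinearMap.range (polyLp hc) : Set (Lp ℂ 2 μ)) := by
    rw [← span_orthoPoly hc]
    have := Submodule.map_span (polySpace hc).subtype (Set.range (orthoVec hc))
    rw [← Set.range_comp] at this
    exact congrArg (fun S : Submodule ℂ (Lp ℂ 2 μ) => (S : Set (Lp ℂ 2 μ))) this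
  rw [h]
  exact f.2

instance (hc : IsCompact μ.support) : CompleteSpace (polySpace hc) :=
  (Submodule.isClosed_topologicalClosure _).completeSpace_coe

/-- The orthonormal polynomials as an orthonormal (Hilbert) basis of `𝒫`. -/
def orthoBasis (hc : IsCompact μ.support) (hinf : μ.support.Infinite) :
    HilbertBasis ℕ ℂ (polySpace hc) :=
  HilbertBasis.mk (orthonormal_orthoVec hc hinf) (dense_orthoVec hc)

/-- `ℓ²(ℕ)`, indexed from `0`. -/
abbrev EllTwo : Type := lp (fun _ : ℕ => ℂ) 2

/-- The Bergman shift matrix `M`, as an operator on `ℓ²`: multiplication by `z` on `𝒫`, written in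
the orthonormal basis `φ_0, φ_1, …`. -/
def bergmanShift (hc : IsCompact μ.support) (hinf : μ.support.Infinite) : EllTwo →L[ℂ] EllTwo :=
  ((orthoBasis hc hinf).repr : polySpace hc →L[ℂ] EllTwo) ∘L mulZRestrict hc ∘L
    ((orthoBasis hc hinf).repr.symm : EllTwo →L[ℂ] polySpace hc)

end Shift

/-! ### Shifts on `ℓ²`, Toeplitz operators, weak convergence -/

/-- The standard basis vector `e_n` of `ℓ²`. -/
def stdVec (n : ℕ) : EllTwo := lp.single 2 n (1 : ℂ)

/-- The matrix entry `⟨e_i, A e_j⟩` of an operator on `ℓ²` (row `i`, column `j`, from `0`). -/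
def entry (A : EllTwo →L[ℂ] EllTwo) (i j : ℕ) : ℂ := ⟪stdVec i, A (stdVec j)⟫_ℂ

lemma entry_bergmanShift {μ : Measure ℂ} [IsFiniteMeasure μ] (hc : IsCompact μ.support)
    (hinf : μ.support.Infinite) (i j : ℕ) :
    entry (bergmanShift hc hinf) i j
      = ∫ z, conj ((orthoPoly μ i).eval z) * (z * (orthoPoly μ j).eval z) ∂μ := by
  have hs : ∀ n, (orthoBasis hc hinf).repr.symm (stdVec n) = orthoVec hc n := fun n => by
    rw [stdVec, HilbertBasis.repr_symm_single, orthoBasis, HilbertBasis.coe_mk]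
  have h1 : entry (bergmanShift hc hinf) i j
      = ⟪orthoVec hc i, mulZRestrict hc (orthoVec hc j)⟫_ℂ := by
    rw [← hs i, ← hs j, ← LinearIsometryEquiv.inner_map_map (orthoBasis hc hinf).repr,
      LinearIsometryEquiv.apply_symm_apply]
    rfl
  rw [h1]
  change ⟪polyLp hc (orthoPoly μ i), mulZ hc (polyLp hc (orthoPoly μ j))⟫_ℂ = _
  rw [mulZ_polyLp, inner_polyLp]
  simp

lemma norm_sq_ellTwo (a : EllTwo) : ‖a‖ ^ 2 = ∑' n, ‖a n‖ ^ 2 := by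
  have h := lp.norm_rpow_eq_tsum (p := 2) (by norm_num) a
  simpa using h

lemma summable_ellTwo (a : EllTwo) : Summable fun n => ‖a n‖ ^ 2 := by
  simpa using (lp.memℓp a).summable (by norm_num)

lemma memℓp_two {a : ℕ → ℂ} (h : Summable fun n => ‖a n‖ ^ 2) : Memℓp a 2 :=
  memℓp_gen (by simpa using h)

/-- The right shift of a sequence, `(a_0, a_1, …) ↦ (0, a_0, a_1, …)`. -/
def shiftSeq (a : ℕ → ℂ) : ℕ → ℂ
  | 0 => 0
  | n + 1 => a n

lemma summable_shiftSeq (a : EllTwo) : Summable fun n => ‖shiftSeq a n‖ ^ 2 := by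
  rw [← summable_nat_add_iff 1]
  exact summable_ellTwo a

lemma tsum_shiftSeq (a : EllTwo) : ∑' n, ‖shiftSeq a n‖ ^ 2 = ∑' n, ‖a n‖ ^ 2 := by
  rw [(summable_shiftSeq a).tsum_eq_zero_add]
  simp [shiftSeq]

/-- The right shift on `ℓ²`. -/
def shiftR : EllTwo →L[ℂ] EllTwo :=
  LinearMap.mkContinuous
    { toFun := fun a => ⟨shiftSeq a, memℓp_two (summable_shiftSeq a)⟩
      map_add' := fun a b => by
        ext n
        cases n with
        | zero => exact (add_zero (0 : ℂ)).symm
        | succ m => rfl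
      map_smul' := fun c a => by
        ext n
        cases n with
        | zero => exact (mul_zero c).symm
        | succ m => rfl } 1 fun a => by
    rw [one_mul]
    refine (sq_le_sq₀ (norm_nonneg _) (norm_nonneg _)).1 ?_
    rw [norm_sq_ellTwo, norm_sq_ellTwo]
    exact (tsum_shiftSeq a).le

/-- The left shift on `ℓ²`, `(a_0, a_1, …) ↦ (a_1, a_2, …)`. -/
def shiftL : EllTwo →L[ℂ] EllTwo :=
  LinearMap.mkContinuous
    { toFun := fun a => ⟨fun n => a (n + 1),
        memℓp_two ((summable_nat_add_iff 1).2 (summable_ellTwo a))⟩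
      map_add' := fun a b => rfl
      map_smul' := fun c a => rfl } 1 fun a => by
    rw [one_mul]
    refine (sq_le_sq₀ (norm_nonneg _) (norm_nonneg _)).1 ?_
    rw [norm_sq_ellTwo, norm_sq_ellTwo, Summable.tsum_eq_zero_add (summable_ellTwo a)]
    exact le_add_of_nonneg_left (sq_nonneg _)

/-- `T` is a Toeplitz operator: its matrix is constant along diagonals, `T_{ij} = a_{j-i}`. -/
def IsToeplitz (T : EllTwo →L[ℂ] EllTwo) : Prop :=
  ∃ a : ℤ → ℂ, ∀ i j : ℕ, entry T i j = a ((j : ℤ) - i)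

/-- `A` is weakly asymptotically Toeplitz: `L^n A R^n` converges, in the weak operator topology,
to a Toeplitz operator. -/
def IsWeaklyAsymptoticallyToeplitz (A : EllTwo →L[ℂ] EllTwo) : Prop :=
  ∃ T : EllTwo →L[ℂ] EllTwo, IsToeplitz T ∧
    Tendsto (fun n : ℕ => ContinuousLinearMapWOT.ofCLM ((shiftL ^ n) ∘L A ∘L (shiftR ^ n))) atTop
      (𝓝 (ContinuousLinearMapWOT.ofCLM T))

/-! ### Ratio asymptotics near infinity -/

/-- The part `R < |z| ≤ ∞` of the Riemann sphere. -/
def nearInfty (R : ℝ) : Set (OnePoint ℂ) :=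
  {OnePoint.infty} ∪ (fun z : ℂ => (z : OnePoint ℂ)) '' {z : ℂ | R < ‖z‖}

/-- `f` is analytic in `R < |z| ≤ ∞`: it is analytic at every finite point, and in the chart
`w = 1/z` it is analytic at the point `w = 0`, i.e. `z = ∞`. -/
def IsAnalyticNearInfty (R : ℝ) (f : OnePoint ℂ → ℂ) : Prop :=
  AnalyticOnNhd ℂ (fun z : ℂ => f z) {z : ℂ | R < ‖z‖} ∧
    AnalyticAt ℂ (fun w : ℂ => if w = 0 then f OnePoint.infty else f (w⁻¹ : ℂ)) 0

/-- The value of the rational function `p / q` at a point of the Riemann sphere; at `∞` it is the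
limit of `p(z) / q(z)` as `|z| → ∞`. -/
def ratioAt (p q : ℂ[X]) : OnePoint ℂ → ℂ
  | OnePoint.infty => limUnder (Bornology.cobounded ℂ) fun z => p.eval z / q.eval z
  | OnePoint.some z => p.eval z / q.eval z

/-- The value at `∞` of `p / q` when `deg p < deg q`. -/
lemma ratioAt_infty {p q : ℂ[X]} (h : p.degree < q.degree) :
    ratioAt p q OnePoint.infty = 0 :=
  (isLittleO_cobounded_of_degree_lt h).tendsto_div_nhds_zero.limUnder_eq

/-- The orthonormal polynomials have ratio asymptotics near `∞`. -/
def HasRatioAsymptotics (μ : Measure ℂ) : Prop :=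
  ∃ R : ℝ, 0 < R ∧ ∃ f : OnePoint ℂ → ℂ, IsAnalyticNearInfty R f ∧
    ∀ z ∈ nearInfty R,
      Tendsto (fun n : ℕ => ratioAt (orthoPoly μ n) (orthoPoly μ (n + 1)) z) atTop (𝓝 (f z))

end OrthPoly

end

open OrthPoly

/-!
In the chart `w = 1 / z` the ratios `φ_n / φ_{n+1}` are holomorphic and uniformly bounded near
`w = 0`, because the Hessenberg recurrence `z φ_n = ∑_{i ≤ n+1} M_{i,n} φ_i` makes `φ_n(z)` grow
geometrically once `|z|` is large compared with `‖M‖`. Pointwise convergence to an analytic limit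
is therefore convergence of all Taylor coefficients at `∞`. Dividing the recurrence by `φ_{n+1}`
expresses these coefficients through the diagonals of `M` by a triangular system whose pivots are
products of the subdiagonal entries `κ_n / κ_{n+1}`. Unless these entries tend to `0`, it is
invertible in the limit, so that the Taylor coefficients converge exactly when `M` converges along
each of its diagonals. This is weak asymptotic Toeplitzness, as `L^n M R^n` is `M` moved up `n`
places along its diagonals.
-/

namespace OrthPoly

open scoped Nat PowerSeries

/-- The sequence `u` has a limit. -/
def Converges {α : Type*} [TopologicalSpace α] (u : ℕ → α) : Prop := ∃ a, Tendsto u atTop (𝓝 a)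

namespace Converges

section Ring

variable {R : Type*} [Ring R] [TopologicalSpace R] [IsTopologicalRing R] {u v : ℕ → R}

lemma sub (hu : Converges u) (hv : Converges v) : Converges fun n => u n - v n :=
  let ⟨_, ha⟩ := hu
  let ⟨_, hb⟩ := hv
  ⟨_, ha.sub hb⟩

lemma mul (hu : Converges u) (hv : Converges v) : Converges fun n => u n * v n :=
  let ⟨_, ha⟩ := hu
  let ⟨_, hb⟩ := hv
  ⟨_, ha.mul hb⟩

lemma sum {ι : Type*} {s : Finset ι} {w : ι → ℕ → R} (hw : ∀ i ∈ s, Converges (w i)) :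
    Converges fun n => ∑ i ∈ s, w i n := by
  choose! a ha using hw
  exact ⟨_, tendsto_finsetSum s ha⟩

end Ring

lemma comp_sub_nat {α : Type*} [TopologicalSpace α] {u : ℕ → α} (hu : Converges u) (k : ℕ) :
    Converges fun n => u (n - k) :=
  let ⟨_, ha⟩ := hu
  ⟨_, ha.comp (tendsto_sub_atTop_nat k)⟩

lemma of_mul_right {K : Type*} [Field K] [TopologicalSpace K] [IsTopologicalRing K]
    [ContinuousInv₀ K] [T1Space K] {u v : ℕ → K} {b : K} (huv : Converges fun n => u n * v n)
    (hv : Tendsto v atTop (𝓝 b)) (hb : b ≠ 0) : Converges u := by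
  obtain ⟨a, ha⟩ := huv
  refine ⟨_, (ha.div hv hb).congr' ?_⟩
  filter_upwards [hv.eventually_ne hb] with n hn using mul_div_cancel_right₀ _ hn

end Converges

section TaylorCoefficients

variable {E : Type*} [NormedAddCommGroup E] [NormedSpace ℂ E]

/-- The `m`-th coefficient of the Taylor expansion of `f` at `c`. -/
noncomputable def taylorCoeff (f : ℂ → E) (c : ℂ) (m : ℕ) : E :=
  (m ! : ℂ)⁻¹ • iteratedDeriv m f c

variable {c : ℂ} {r C : ℝ}

lemma tendsto_circleIntegral_of_dominated {F : ℕ → ℂ → E} {f : ℂ → E}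
    (hF : ∀ n, ContinuousOn (F n) (Metric.sphere c |r|))
    (hC : ∀ n, ∀ z ∈ Metric.sphere c |r|, ‖F n z‖ ≤ C)
    (hlim : ∀ z ∈ Metric.sphere c |r|, Tendsto (fun n => F n z) atTop (𝓝 (f z))) :
    Tendsto (fun n => ∮ z in C(c, r), F n z) atTop (𝓝 (∮ z in C(c, r), f z)) := by
  refine intervalIntegral.tendsto_integral_filter_of_dominated_convergence (fun _ => |r| * C)
    (Eventually.of_forall fun n => ?_) (Eventually.of_forall fun n => ae_of_all _ fun θ _ => ?_)
    intervalIntegrable_const (ae_of_all _ fun θ _ => ?_)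
  · have hcont : Continuous fun θ => F n (circleMap c r θ) :=
      (hF n).comp_continuous (continuous_circleMap c r) (circleMap_mem_sphere' c r)
    simp only [deriv_circleMap]
    exact (Continuous.smul (by fun_prop) hcont).aestronglyMeasurable
  · rw [norm_smul]
    simp only [deriv_circleMap, norm_mul, norm_circleMap_zero, Complex.norm_I, mul_one]
    gcongr
    exact hC n _ (circleMap_mem_sphere' c r θ)
  · exact (hlim _ (circleMap_mem_sphere' c r θ)).const_smul _

variable [CompleteSpace E]

lemma hasSum_taylorCoeff {f : ℂ → E} (hf : DifferentiableOn ℂ f (Metric.ball c r)) {z : ℂ}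
    (hz : z ∈ Metric.ball c r) : HasSum (fun m => (z - c) ^ m • taylorCoeff f c m) (f z) := by
  simpa only [taylorCoeff, smul_comm (_ ^ _)] using Complex.hasSum_taylorSeries_on_ball hf hz

lemma norm_taylorCoeff_le {f : ℂ → E} (hr : 0 < r) (hf : DiffContOnCl ℂ f (Metric.ball c r))
    (hC : ∀ z ∈ Metric.sphere c r, ‖f z‖ ≤ C) (m : ℕ) : ‖taylorCoeff f c m‖ ≤ C / r ^ m := by
  have h := Complex.norm_iteratedDeriv_le_of_forall_mem_sphere_norm_le m hr hf hC
  rw [taylorCoeff, norm_smul, norm_inv, Complex.norm_natCast, inv_mul_le_iff₀ (by positivity)]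
  rwa [← mul_div_assoc]

lemma taylorCoeff_eq_circleIntegral {f : ℂ → E} (hr : 0 < r)
    (hf : DiffContOnCl ℂ f (Metric.ball c r)) (m : ℕ) :
    taylorCoeff f c m = (2 * Real.pi * Complex.I : ℂ)⁻¹ •
      ∮ z in C(c, r), (1 / (z - c) ^ (m + 1)) • f z := by
  rw [hf.circleIntegral_one_div_sub_center_pow_smul hr m, smul_smul, taylorCoeff]
  congr 1
  field_simp

lemma converges_taylorCoeff_of_sphere {F : ℕ → ℂ → E} (hr : 0 < r)
    (hF : ∀ n, DiffContOnCl ℂ (F n) (Metric.ball c r))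
    (hC : ∀ n, ∀ z ∈ Metric.sphere c r, ‖F n z‖ ≤ C)
    (hlim : ∀ z ∈ Metric.sphere c r, Converges fun n => F n z) (m : ℕ) :
    Converges fun n => taylorCoeff (F n) c m := by
  choose! f hf using hlim
  simp only [taylorCoeff_eq_circleIntegral hr (hF _)]
  rw [← abs_of_pos hr] at hC hf
  have hcont (n : ℕ) : ContinuousOn (F n) (Metric.sphere c |r|) := by
    rw [abs_of_pos hr]
    exact (hF n).continuousOn_ball.mono Metric.sphere_subset_closedBall
  have hne {z : ℂ} (hz : z ∈ Metric.sphere c |r|) : (z - c) ^ (m + 1) ≠ 0 := by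
    refine pow_ne_zero _ (sub_ne_zero.2 ?_)
    exact Metric.ne_of_mem_sphere hz (abs_pos.2 hr.ne').ne'
  refine ⟨_, (tendsto_circleIntegral_of_dominated (C := 1 / r ^ (m + 1) * C) (fun n => ?_)
    (fun n z hz => ?_) fun z hz => (hf z hz).const_smul _).const_smul _⟩
  · exact (continuousOn_const.div (by fun_prop) fun z hz => hne hz).smul (hcont n)
  · rw [norm_smul, norm_div, norm_one, norm_pow, mem_sphere_iff_norm.1 hz, abs_of_pos hr]
    gcongr
    exact hC n z hz

/-- The power series about `c` with the limit coefficients converges on the ball, by the Cauchy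
estimates. -/
lemma exists_analyticOnNhd_tendsto_of_converges_taylorCoeff {F : ℕ → ℂ → E} (hr : 0 < r)
    (hF : ∀ n, DiffContOnCl ℂ (F n) (Metric.ball c r))
    (hC : ∀ n, ∀ z ∈ Metric.sphere c r, ‖F n z‖ ≤ C)
    (hlim : ∀ m, Converges fun n => taylorCoeff (F n) c m) :
    ∃ f : ℂ → E, AnalyticOnNhd ℂ f (Metric.ball c r) ∧
      ∀ z ∈ Metric.ball c r, Tendsto (fun n => F n z) atTop (𝓝 (f z)) := by
  choose a ha using hlim
  have hbound (n m : ℕ) : ‖taylorCoeff (F n) c m‖ ≤ C / r ^ m :=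
    norm_taylorCoeff_le hr (hF n) (hC n) m
  have hbound' (m : ℕ) : ‖a m‖ ≤ C / r ^ m :=
    le_of_tendsto (ha m).norm (Eventually.of_forall fun n => hbound n m)
  let p : FormalMultilinearSeries ℂ ℂ E := fun m =>
    ContinuousMultilinearMap.mkPiRing ℂ (Fin m) (a m)
  have hrad : ENNReal.ofReal r ≤ p.radius := by
    refine p.le_radius_of_bound C fun m => ?_
    rw [ContinuousMultilinearMap.norm_mkPiRing, Real.coe_toNNReal r hr.le]
    exact (le_div_iff₀ (by positivity)).1 (hbound' m)
  have hp : HasFPowerSeriesOnBall (fun z => p.sum (z - c)) p c p.radius := by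
    simpa using (p.hasFPowerSeriesOnBall
      ((ENNReal.ofReal_pos.2 hr).trans_le hrad)).comp_sub c
  refine ⟨_, hp.analyticOnNhd.mono ?_, fun z hz => ?_⟩
  · rw [← Metric.eball_ofReal]
    exact Metric.eball_subset_eball hrad
  have hratio : ‖z - c‖ / r < 1 := (div_lt_one hr).2 (mem_ball_iff_norm.1 hz)
  have hsum : Summable fun m => C * (‖z - c‖ / r) ^ m :=
    (summable_geometric_of_lt_one (by positivity) hratio).mul_left C
  simp only [FormalMultilinearSeries.sum, p, ContinuousMultilinearMap.mkPiRing_apply,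
    Finset.prod_const, Finset.card_fin]
  refine (tendsto_tsum_of_dominated_convergence hsum (fun m => (ha m).const_smul _)
    (Eventually.of_forall fun n m => ?_)).congr fun n =>
      (hasSum_taylorCoeff (hF n).differentiableOn hz).tsum_eq
  calc ‖(z - c) ^ m • taylorCoeff (F n) c m‖ ≤ ‖z - c‖ ^ m * (C / r ^ m) := by
        rw [norm_smul, norm_pow]
        gcongr
        exact hbound n m
    _ = C * (‖z - c‖ / r) ^ m := by rw [div_pow]; ring

end TaylorCoefficients

section TaylorSeries

/-- The Taylor expansion of `f` at `0` as a formal power series. -/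
noncomputable def taylorSeries (f : ℂ → ℂ) : ℂ⟦X⟧ := PowerSeries.mk (taylorCoeff f 0)

lemma taylorSeries_congr {f g : ℂ → ℂ} (h : f =ᶠ[𝓝 0] g) : taylorSeries f = taylorSeries g := by
  ext m
  simp only [taylorSeries, PowerSeries.coeff_mk, taylorCoeff, h.iteratedDeriv_eq]

lemma taylorSeries_mul {f g : ℂ → ℂ} (hf : AnalyticAt ℂ f 0) (hg : AnalyticAt ℂ g 0) :
    taylorSeries (f * g) = taylorSeries f * taylorSeries g := by
  ext m
  simp only [taylorSeries, PowerSeries.coeff_mul, PowerSeries.coeff_mk, taylorCoeff, smul_eq_mul]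
  rw [iteratedDeriv_mul hf.contDiffAt hg.contDiffAt, Finset.mul_sum,
    Finset.Nat.sum_antidiagonal_eq_sum_range_succ_mk]
  refine Finset.sum_congr rfl fun i hi => ?_
  rw [Nat.cast_choose ℂ (Finset.mem_range_succ_iff.1 hi)]
  have h := Nat.cast_ne_zero (R := ℂ).2 m.factorial_ne_zero
  field_simp

lemma taylorSeries_eval (p : ℂ[X]) : taylorSeries (fun z => p.eval z) = p := by
  have hiter (m : ℕ) : iteratedDeriv m (fun z => p.eval z) =
      fun z => (derivative^[m] p).eval z := by
    induction m with
    | zero => rfl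
    | succ m ih =>
      ext z
      rw [iteratedDeriv_succ, ih, Polynomial.deriv, Function.iterate_succ_apply']
  ext m
  rw [taylorSeries, PowerSeries.coeff_mk, taylorCoeff, hiter]
  beta_reduce
  rw [← coeff_zero_eq_eval_zero, coeff_iterate_derivative, zero_add,
    Nat.descFactorial_self, coeff_coe, nsmul_eq_mul, smul_eq_mul,
    inv_mul_cancel_left₀ (Nat.cast_ne_zero.2 m.factorial_ne_zero)]

lemma taylorSeries_div {f g : ℂ → ℂ} (hf : AnalyticAt ℂ f 0) (hg : AnalyticAt ℂ g 0)
    (h0 : g 0 ≠ 0) : taylorSeries (f / g) = taylorSeries f * (taylorSeries g)⁻¹ := by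
  rw [PowerSeries.eq_mul_inv_iff_mul_eq
    (by simpa [taylorSeries, taylorCoeff, PowerSeries.coeff_zero_eq_constantCoeff] using h0),
    ← taylorSeries_mul (hf.div hg h0) hg]
  refine taylorSeries_congr ?_
  filter_upwards [hg.continuousAt.eventually_ne h0] with z hz
  exact div_mul_cancel₀ _ hz

end TaylorSeries

section LongRecurrence

variable {K : Type*} [Field K]

/-- The formal power series `S_n` satisfy `S_n = ∑_{k ≥ 0} d_k(n) X^k S_n S_{n-1} ⋯ S_{n-k+1}`,
read off coefficient by coefficient. -/
def SolvesLongRecurrence (d : ℕ → ℕ → K) (S : ℕ → K⟦X⟧) : Prop :=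
  ∀ n j, PowerSeries.coeff j (S n) = ∑ k ∈ Finset.range (j + 1),
    d k n * PowerSeries.coeff (j - k) (∏ i ∈ Finset.range k, S (n - i))

variable {d : ℕ → ℕ → K} {S : ℕ → K⟦X⟧}

lemma SolvesLongRecurrence.coeff_zero (hS : SolvesLongRecurrence d S) (n : ℕ) :
    PowerSeries.coeff 0 (S n) = d 0 n := by
  rw [hS, Finset.sum_range_one]
  simp

variable [TopologicalSpace K] [IsTopologicalRing K]

lemma converges_coeff_prod_shift {j : ℕ}
    (h : ∀ i ≤ j, Converges fun n => PowerSeries.coeff i (S n)) (k : ℕ) :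
    Converges fun n => PowerSeries.coeff j (∏ i ∈ Finset.range k, S (n - i)) := by
  induction k generalizing j with
  | zero => simpa only [Finset.range_zero, Finset.prod_empty] using ⟨_, tendsto_const_nhds⟩
  | succ k ih =>
    simp only [Finset.prod_range_succ, PowerSeries.coeff_mul]
    refine Converges.sum fun ij hij => (ih fun i hi => h i ?_).mul ((h ij.2 ?_).comp_sub_nat k)
    · exact hi.trans ((Finset.HasAntidiagonal.mem_antidiagonal.1 hij ▸ Nat.le_add_right _ _))
    · exact Finset.HasAntidiagonal.mem_antidiagonal.1 hij ▸ Nat.le_add_left _ _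

namespace SolvesLongRecurrence

lemma converges_coeff_of_converges (hS : SolvesLongRecurrence d S) (hd : ∀ k, Converges (d k))
    (j : ℕ) : Converges fun n => PowerSeries.coeff j (S n) := by
  induction j using Nat.strong_induction_on with
  | _ j ih =>
    simp only [hS _ j]
    refine Converges.sum fun k hkj => (hd k).mul ?_
    have hkj := Finset.mem_range_succ_iff.1 hkj
    obtain rfl | hk := k.eq_zero_or_pos
    · simpa only [Finset.range_zero, Finset.prod_empty] using ⟨_, tendsto_const_nhds⟩
    · exact converges_coeff_prod_shift (fun i hi => ih i (by omega)) k

lemma tendsto_coeff_zero_prod_shift (hS : SolvesLongRecurrence d S) {a : K}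
    (ha : Tendsto (d 0) atTop (𝓝 a)) (k : ℕ) :
    Tendsto (fun n => PowerSeries.coeff 0 (∏ i ∈ Finset.range k, S (n - i))) atTop
      (𝓝 (a ^ k)) := by
  have h : Tendsto (fun n => ∏ i ∈ Finset.range k, d 0 (n - i)) atTop
      (𝓝 (∏ _i ∈ Finset.range k, a)) :=
    tendsto_finsetProd _ fun i _ => ha.comp (tendsto_sub_atTop_nat i)
  rw [Finset.prod_const, Finset.card_range] at h
  refine h.congr fun n => ?_
  simp only [← hS.coeff_zero, PowerSeries.coeff_zero_eq_constantCoeff, map_prod]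

variable [ContinuousInv₀ K] [T1Space K]

/-- The recurrence is triangular in `d`, with pivots tending to the powers of `a`. -/
lemma converges_of_converges_coeff (hS : SolvesLongRecurrence d S) {a : K}
    (ha : Tendsto (d 0) atTop (𝓝 a)) (ha0 : a ≠ 0)
    (h : ∀ j, Converges fun n => PowerSeries.coeff j (S n)) (k : ℕ) : Converges (d k) := by
  induction k using Nat.strong_induction_on with
  | _ k ih =>
    have hlower : Converges fun n => ∑ i ∈ Finset.range k,
        d i n * PowerSeries.coeff (k - i) (∏ l ∈ Finset.range i, S (n - l)) :=
      Converges.sum fun i hi => (ih i (Finset.mem_range.1 hi)).mul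
        (converges_coeff_prod_shift (fun l _ => h l) i)
    refine Converges.of_mul_right ?_ (hS.tendsto_coeff_zero_prod_shift ha k) (pow_ne_zero k ha0)
    convert (h k).sub hlower using 2 with n
    rw [hS n k, Finset.sum_range_succ, Nat.sub_self, add_sub_cancel_left]

end SolvesLongRecurrence

end LongRecurrence

section Hessenberg

variable {K : Type*} [Field K]

/-- The diagonals of a Hessenberg matrix, counted from the subdiagonal, which is the zeroth one;
they are padded with zeros on the left so that `diagonal m k n` lies in column `n`. -/
def diagonal {α : Type*} [Zero α] (m : ℕ → ℕ → α) (k n : ℕ) : α :=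
  if k ≤ n + 1 then m (n + 1 - k) n else 0

/-- The polynomials `p_n` satisfy `X p_n = ∑_{i ≤ n+1} m_{i,n} p_i`: the matrix of multiplication by
`X` in the basis `p_0, p_1, …` is the Hessenberg part of `m`. -/
def SolvesHessenberg (m : ℕ → ℕ → K) (p : ℕ → K[X]) : Prop :=
  ∀ n, X * p n = ∑ i ∈ Finset.range (n + 2), C (m i n) * p i

variable (p : Polynomial.Sequence K) {m : ℕ → ℕ → K}

/-- The expansion of `p_n / p_{n+1}` at `∞` in powers of `X = 1/z`, divided by its leading factor
`X`. -/
noncomputable def ratioSeries (n : ℕ) : K⟦X⟧ :=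
  ((p n).reverse : K⟦X⟧) * ((p (n + 1)).reverse : K⟦X⟧)⁻¹

variable {p}

lemma constantCoeff_reverse_ne_zero (n : ℕ) :
    PowerSeries.constantCoeff ((p n).reverse : K⟦X⟧) ≠ 0 := by
  rw [Polynomial.constantCoeff_coe, coeff_zero_reverse, leadingCoeff_ne_zero]
  exact p.ne_zero n

lemma reverse_mul_inv_reverse (n : ℕ) :
    ((p n).reverse : K⟦X⟧) * ((p n).reverse : K⟦X⟧)⁻¹ = 1 :=
  PowerSeries.mul_inv_cancel _ (constantCoeff_reverse_ne_zero n)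

lemma prod_ratioSeries {n k : ℕ} (hk : k ≤ n + 1) :
    ∏ i ∈ Finset.range k, ratioSeries p (n - i) =
      ((p (n + 1 - k)).reverse : K⟦X⟧) * ((p (n + 1)).reverse : K⟦X⟧)⁻¹ := by
  induction k with
  | zero => rw [Finset.prod_range_zero, Nat.sub_zero, reverse_mul_inv_reverse]
  | succ k ih =>
    rw [Finset.prod_range_succ, ih (by omega), ratioSeries, show n - k + 1 = n + 1 - k by omega,
      show n + 1 - (k + 1) = n - k by omega]
    linear_combination ((p (n - k)).reverse : K⟦X⟧) * ((p (n + 1)).reverse : K⟦X⟧)⁻¹ *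
      reverse_mul_inv_reverse (p := p) (n + 1 - k)

lemma SolvesHessenberg.reverse_eq (h : SolvesHessenberg m p) (n : ℕ) :
    (p n).reverse = ∑ k ∈ Finset.range (n + 2),
      C (diagonal m k n) * X ^ k * (p (n + 1 - k)).reverse := by
  have hrev (i : ℕ) : (p i).reverse = (p i).reflect i := by simp only [reverse, p.natDegree_eq]
  have hreflect {k : ℕ} (hk : k ≤ n + 1) :
      (p (n + 1 - k)).reflect (n + 1) = X ^ k * (p (n + 1 - k)).reverse := by
    have := reflect_mul (1 : K[X]) (p (n + 1 - k)) (F := k) (by simp) (p.natDegree_eq _).le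
    rwa [one_mul, Nat.add_sub_cancel' hk, reflect_one, ← hrev] at this
  have hX : (X * p n).natDegree = n + 1 := by
    rw [natDegree_X_mul (p.ne_zero n), p.natDegree_eq]
  calc (p n).reverse = (X * p n).reflect (n + 1) := by rw [← hX, ← reverse_X_mul]; rfl
    _ = ∑ i ∈ Finset.range (n + 2), C (m i n) * (p i).reflect (n + 1) := by
      have hadd := map_sum (AddMonoidHom.mk' (reflect (R := K) (n + 1)) fun f g =>
        reflect_add f g (n + 1)) (fun i => C (m i n) * p i) (Finset.range (n + 2))
      simpa only [h n, AddMonoidHom.mk'_apply, reflect_C_mul] using hadd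
    _ = _ := by
      rw [← Finset.sum_range_reflect]
      refine Finset.sum_congr rfl fun k hk => ?_
      have hk' : k ≤ n + 1 := Finset.mem_range_succ_iff.1 hk
      rw [show n + 2 - 1 - k = n + 1 - k by omega, diagonal, if_pos hk', hreflect hk', mul_assoc]

/-- Divide the reversed recurrence by the reverse of `p_{n+1}`. -/
lemma SolvesHessenberg.solvesLongRecurrence (h : SolvesHessenberg m p) :
    SolvesLongRecurrence (diagonal m) (ratioSeries p) := by
  intro n j
  have hterm (k : ℕ) : PowerSeries.coeff j (((C (diagonal m k n) * X ^ k *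
      (p (n + 1 - k)).reverse : K[X]) : K⟦X⟧) * ((p (n + 1)).reverse : K⟦X⟧)⁻¹) =
      diagonal m k n * if k ≤ j then PowerSeries.coeff (j - k)
        (((p (n + 1 - k)).reverse : K⟦X⟧) * ((p (n + 1)).reverse : K⟦X⟧)⁻¹) else 0 := by
    rw [coe_mul, coe_mul, coe_C, coe_pow, coe_X, mul_assoc, mul_assoc, PowerSeries.coeff_C_mul,
      PowerSeries.coeff_X_pow_mul']
  rw [ratioSeries, h.reverse_eq, ← coeToPowerSeries.ringHom_apply, map_sum, Finset.sum_mul, map_sum]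
  simp only [coeToPowerSeries.ringHom_apply, hterm]
  refine Finset.sum_congr_of_eq_on_inter (fun k _ hk => ?_) (fun k _ hk => ?_) fun k hk hkj => ?_
  · rw [if_neg (mt Finset.mem_range_succ_iff.2 hk), mul_zero]
  · rw [diagonal, if_neg (mt Finset.mem_range_succ_iff.2 hk), zero_mul]
  · rw [if_pos (Finset.mem_range_succ_iff.1 hkj), prod_ratioSeries (Finset.mem_range_succ_iff.1 hk)]

end Hessenberg

section Growth

variable {K : Type*} [NormedField K] {p : Polynomial.Sequence K} {m : ℕ → ℕ → K} {B : ℝ}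

namespace SolvesHessenberg

lemma mul_eval (h : SolvesHessenberg m p) (z : K) (n : ℕ) :
    z * (p n).eval z = ∑ i ∈ Finset.range (n + 2), m i n * (p i).eval z := by
  simpa [eval_finsetSum] using congrArg (eval z) (h n)

lemma bound_pos (h : SolvesHessenberg m p) (hm : ∀ i j, ‖m i j‖ ≤ B) : 0 < B := by
  by_contra! hB
  have hm0 (i j : ℕ) : m i j = 0 := norm_le_zero_iff.1 ((hm i j).trans hB)
  have hX : X * p 0 = 0 := by simpa [hm0] using h 0
  exact mul_ne_zero X_ne_zero (p.ne_zero 0) hX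

lemma two_mul_norm_eval_le_of_sum_le (h : SolvesHessenberg m p) (hm : ∀ i j, ‖m i j‖ ≤ B) {z : K}
    (hz : 4 * B ≤ ‖z‖) {n : ℕ}
    (hsum : ∑ i ∈ Finset.range (n + 1), ‖(p i).eval z‖ ≤ 2 * ‖(p n).eval z‖) :
    2 * ‖(p n).eval z‖ ≤ ‖(p (n + 1)).eval z‖ := by
  have hB := h.bound_pos hm
  have hupper : ‖z‖ * ‖(p n).eval z‖ ≤
      B * (2 * ‖(p n).eval z‖) + B * ‖(p (n + 1)).eval z‖ :=
    calc ‖z‖ * ‖(p n).eval z‖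
        = ‖∑ i ∈ Finset.range (n + 2), m i n * (p i).eval z‖ := by rw [← norm_mul, h.mul_eval]
      _ ≤ ∑ i ∈ Finset.range (n + 2), B * ‖(p i).eval z‖ :=
        norm_sum_le_of_le _ fun i _ => by rw [norm_mul]; gcongr; exact hm i n
      _ = B * ∑ i ∈ Finset.range (n + 1), ‖(p i).eval z‖ + B * ‖(p (n + 1)).eval z‖ := by
        rw [Finset.sum_range_succ, Finset.mul_sum]
      _ ≤ _ := by gcongr
  have hlower : 4 * B * ‖(p n).eval z‖ ≤ ‖z‖ * ‖(p n).eval z‖ := by gcongr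
  exact le_of_mul_le_mul_left (by linarith) hB

lemma eval_ne_zero_and_sum_le (h : SolvesHessenberg m p) (hm : ∀ i j, ‖m i j‖ ≤ B) {z : K}
    (hz : 4 * B ≤ ‖z‖) (n : ℕ) : (p n).eval z ≠ 0 ∧
      ∑ i ∈ Finset.range (n + 1), ‖(p i).eval z‖ ≤ 2 * ‖(p n).eval z‖ := by
  induction n with
  | zero =>
    have hC : p 0 = C ((p 0).coeff 0) := eq_C_of_natDegree_eq_zero (p.natDegree_eq 0)
    refine ⟨?_, ?_⟩
    · rw [hC, eval_C]
      exact fun h0 => p.ne_zero 0 (by rw [hC, h0, C_0])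
    · rw [zero_add, Finset.sum_range_one]
      linarith [norm_nonneg ((p 0).eval z)]
  | succ n ih =>
    have hgrow := h.two_mul_norm_eval_le_of_sum_le hm hz ih.2
    have hpos := norm_pos_iff.2 ih.1
    refine ⟨norm_pos_iff.1 (by linarith), ?_⟩
    rw [Finset.sum_range_succ]
    linarith [ih.2]

lemma eval_ne_zero (h : SolvesHessenberg m p) (hm : ∀ i j, ‖m i j‖ ≤ B) {z : K}
    (hz : 4 * B ≤ ‖z‖) (n : ℕ) : (p n).eval z ≠ 0 :=
  (h.eval_ne_zero_and_sum_le hm hz n).1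

lemma norm_eval_div_eval_succ_le (h : SolvesHessenberg m p) (hm : ∀ i j, ‖m i j‖ ≤ B) {z : K}
    (hz : 4 * B ≤ ‖z‖) (n : ℕ) : ‖(p n).eval z / (p (n + 1)).eval z‖ ≤ 1 / 2 := by
  have hgrow := h.two_mul_norm_eval_le_of_sum_le hm hz (h.eval_ne_zero_and_sum_le hm hz n).2
  rw [norm_div, div_le_iff₀ (norm_pos_iff.2 (h.eval_ne_zero hm hz (n + 1)))]
  linarith

end SolvesHessenberg

end Growth

section RatioNearInfty

section Field

variable {K : Type*} [Field K] {p : Polynomial.Sequence K}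

lemma eval_reverse (f : K[X]) {w : K} (hw : w ≠ 0) :
    f.reverse.eval w = w ^ f.natDegree * f.eval w⁻¹ := by
  let := invertibleOfNonzero (inv_ne_zero hw)
  have h := eval₂_reverse_mul_pow (RingHom.id K) w⁻¹ f
  rw [invOf_eq_inv, inv_inv, inv_pow, ← div_eq_mul_inv] at h
  exact (((div_eq_iff_mul_eq (pow_ne_zero _ hw)).1 h).symm.trans (mul_comm _ _))

/-- The ratio `p_n / p_{n+1}` in the chart `w = 1 / z` around `∞`. -/
noncomputable def chartRatio (p : Polynomial.Sequence K) (n : ℕ) (w : K) : K :=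
  w * (p n).reverse.eval w / (p (n + 1)).reverse.eval w

lemma chartRatio_zero (n : ℕ) : chartRatio p n 0 = 0 := by
  rw [chartRatio, zero_mul, zero_div]

lemma chartRatio_eq_eval_inv (n : ℕ) {w : K} (hw : w ≠ 0) :
    chartRatio p n w = (p n).eval w⁻¹ / (p (n + 1)).eval w⁻¹ := by
  rw [chartRatio, eval_reverse _ hw, eval_reverse _ hw, p.natDegree_eq, p.natDegree_eq,
    ← mul_assoc, ← pow_succ', mul_div_mul_left _ _ (pow_ne_zero _ hw)]

lemma eval_zero_reverse_ne_zero (n : ℕ) : (p n).reverse.eval 0 ≠ 0 := by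
  rw [← coeff_zero_eq_eval_zero, coeff_zero_reverse, leadingCoeff_ne_zero]
  exact p.ne_zero n

end Field

section NormedField

variable {K : Type*} [NormedField K] {p : Polynomial.Sequence K} {m : ℕ → ℕ → K} {B : ℝ} {w : K}

lemma le_norm_inv_of_mem_closedBall (hB : 0 < B) (hw : w ∈ Metric.closedBall 0 (4 * B)⁻¹)
    (hw0 : w ≠ 0) : 4 * B ≤ ‖w⁻¹‖ := by
  rw [mem_closedBall_zero_iff] at hw
  rw [norm_inv]
  exact (le_inv_comm₀ (by positivity) (norm_pos_iff.2 hw0)).2 hw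

namespace SolvesHessenberg

lemma eval_reverse_ne_zero (h : SolvesHessenberg m p) (hm : ∀ i j, ‖m i j‖ ≤ B)
    (hw : w ∈ Metric.closedBall 0 (4 * B)⁻¹) (n : ℕ) : (p n).reverse.eval w ≠ 0 := by
  obtain rfl | hw0 := eq_or_ne w 0
  · exact eval_zero_reverse_ne_zero n
  · rw [eval_reverse _ hw0]
    exact mul_ne_zero (pow_ne_zero _ hw0)
      (h.eval_ne_zero hm (le_norm_inv_of_mem_closedBall (h.bound_pos hm) hw hw0) n)

lemma norm_chartRatio_le (h : SolvesHessenberg m p) (hm : ∀ i j, ‖m i j‖ ≤ B)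
    (hw : w ∈ Metric.closedBall 0 (4 * B)⁻¹) (n : ℕ) : ‖chartRatio p n w‖ ≤ 1 / 2 := by
  obtain rfl | hw0 := eq_or_ne w 0
  · rw [chartRatio_zero, norm_zero]
    norm_num
  · rw [chartRatio_eq_eval_inv n hw0]
    exact h.norm_eval_div_eval_succ_le hm
      (le_norm_inv_of_mem_closedBall (h.bound_pos hm) hw hw0) n

end SolvesHessenberg

end NormedField

variable {p : Polynomial.Sequence ℂ}

lemma taylorSeries_chartRatio (n : ℕ) :
    taylorSeries (chartRatio p n) = PowerSeries.X * ratioSeries p n := by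
  have hnum : (fun w => w * (p n).reverse.eval w) = fun w => (X * (p n).reverse).eval w := by
    simp only [eval_mul, eval_X]
  have hanalytic (q : ℂ[X]) : AnalyticAt ℂ (fun w => q.eval w) 0 :=
    q.differentiable.analyticAt 0
  have hdiv : chartRatio p n =
      (fun w => (X * (p n).reverse).eval w) / fun w => (p (n + 1)).reverse.eval w := by
    rw [← hnum]; rfl
  rw [hdiv, taylorSeries_div (hanalytic _) (hanalytic _) (eval_zero_reverse_ne_zero _),
    taylorSeries_eval, taylorSeries_eval, coe_mul, coe_X, ratioSeries, mul_assoc]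

lemma converges_taylorCoeff_chartRatio_iff :
    (∀ j, Converges fun n => taylorCoeff (chartRatio p n) 0 j) ↔
      ∀ j, Converges fun n => PowerSeries.coeff j (ratioSeries p n) := by
  have hcoeff (n j : ℕ) : taylorCoeff (chartRatio p n) 0 j =
      PowerSeries.coeff j (PowerSeries.X * ratioSeries p n) := by
    rw [← taylorSeries_chartRatio, taylorSeries, PowerSeries.coeff_mk]
  simp only [hcoeff]
  refine ⟨fun h j => ?_, fun h j => ?_⟩
  · simpa only [PowerSeries.coeff_succ_X_mul] using h (j + 1)
  · cases j with
    | zero => simpa only [PowerSeries.coeff_zero_X_mul] using ⟨_, tendsto_const_nhds⟩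
    | succ j => simpa only [PowerSeries.coeff_succ_X_mul] using h j

namespace SolvesHessenberg

variable {m : ℕ → ℕ → ℂ} {B : ℝ}

lemma diffContOnCl_chartRatio (h : SolvesHessenberg m p) (hm : ∀ i j, ‖m i j‖ ≤ B) {r : ℝ}
    (hr : r ≤ (4 * B)⁻¹) (n : ℕ) : DiffContOnCl ℂ (chartRatio p n) (Metric.ball 0 r) := by
  refine DifferentiableOn.diffContOnCl_ball (U := Metric.closedBall 0 (4 * B)⁻¹) ?_
    (Metric.closedBall_subset_closedBall hr)
  exact ((differentiable_id.mul (p n).reverse.differentiable).differentiableOn).div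
    (p (n + 1)).reverse.differentiable.differentiableOn
    fun w hw => h.eval_reverse_ne_zero hm hw (n + 1)

lemma converges_coeff_ratioSeries_of_eval (h : SolvesHessenberg m p)
    (hm : ∀ i j, ‖m i j‖ ≤ B) {R : ℝ}
    (hlim : ∀ z : ℂ, R < ‖z‖ → Converges fun n => (p n).eval z / (p (n + 1)).eval z) (j : ℕ) :
    Converges fun n => PowerSeries.coeff j (ratioSeries p n) := by
  refine converges_taylorCoeff_chartRatio_iff.1 (fun k => ?_) j
  have hB := h.bound_pos hm
  have hr : 0 < (max (4 * B) (R + 1))⁻¹ := by positivity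
  have hrB : (max (4 * B) (R + 1))⁻¹ ≤ (4 * B)⁻¹ := by gcongr; exact le_max_left _ _
  refine converges_taylorCoeff_of_sphere hr (h.diffContOnCl_chartRatio hm hrB)
    (fun n w hw => h.norm_chartRatio_le hm ?_ n) (fun w hw => ?_) k
  · exact Metric.closedBall_subset_closedBall hrB (Metric.sphere_subset_closedBall hw)
  · have hnorm : ‖w‖ = (max (4 * B) (R + 1))⁻¹ := mem_sphere_zero_iff_norm.1 hw
    simp only [chartRatio_eq_eval_inv _ (norm_pos_iff.1 (hr.trans_eq hnorm.symm))]
    refine hlim _ ?_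
    rw [norm_inv, hnorm, inv_inv]
    exact (lt_add_one R).trans_le (le_max_right _ _)

lemma exists_analyticOnNhd_tendsto_chartRatio (h : SolvesHessenberg m p)
    (hm : ∀ i j, ‖m i j‖ ≤ B)
    (hlim : ∀ j, Converges fun n => PowerSeries.coeff j (ratioSeries p n)) :
    ∃ g : ℂ → ℂ, AnalyticOnNhd ℂ g (Metric.ball 0 (4 * B)⁻¹) ∧
      ∀ w ∈ Metric.ball 0 (4 * B)⁻¹, Tendsto (fun n => chartRatio p n w) atTop (𝓝 (g w)) := by
  have hB := h.bound_pos hm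
  exact exists_analyticOnNhd_tendsto_of_converges_taylorCoeff (by positivity)
    (h.diffContOnCl_chartRatio hm le_rfl)
    (fun n w hw => h.norm_chartRatio_le hm (Metric.sphere_subset_closedBall hw) n)
    (converges_taylorCoeff_chartRatio_iff.2 hlim)

end SolvesHessenberg

end RatioNearInfty

section WeakConvergence

lemma converges_apply_of_dense_span {𝕜 E F : Type*} [NontriviallyNormedField 𝕜]
    [NormedAddCommGroup E] [NormedSpace 𝕜 E] [NormedAddCommGroup F] [NormedSpace 𝕜 F]
    [CompleteSpace F] {u : ℕ → E →L[𝕜] F} {C : ℝ} (hu : ∀ n, ‖u n‖ ≤ C) {s : Set E}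
    (hs : (Submodule.span 𝕜 s).topologicalClosure = ⊤) (h : ∀ x ∈ s, Converges fun n => u n x)
    (x : E) : Converges fun n => u n x := by
  have hspan (y : E) (hy : y ∈ Submodule.span 𝕜 s) : CauchySeq fun n => u n y := by
    obtain ⟨a, ha⟩ : Converges fun n => u n y := by
      induction hy using Submodule.span_induction with
      | mem y hy => exact h y hy
      | zero => simpa only [map_zero] using ⟨0, tendsto_const_nhds⟩
      | add y z _ _ hy hz =>
        obtain ⟨⟨a, ha⟩, b, hb⟩ := hy, hz
        simpa only [map_add] using ⟨_, ha.add hb⟩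
      | smul c y _ hy =>
        obtain ⟨a, ha⟩ := hy
        simpa only [map_smul] using ⟨_, ha.const_smul c⟩
    exact ha.cauchySeq
  refine cauchySeq_tendsto_of_complete (Metric.cauchySeq_iff'.2 fun ε hε => ?_)
  have hC : 0 ≤ C := (norm_nonneg _).trans (hu 0)
  obtain ⟨y, hy, hxy⟩ := Metric.mem_closure_iff.1
    (hs ▸ Submodule.mem_top : x ∈ (Submodule.span 𝕜 s).topologicalClosure) (ε / (3 * (C + 1)))
    (by positivity)
  have hclose (n : ℕ) : dist (u n x) (u n y) < ε / 3 :=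
    calc dist (u n x) (u n y) ≤ C * dist x y := by
          rw [dist_eq_norm, dist_eq_norm, ← map_sub]
          exact (u n).le_of_opNorm_le (hu n) _
      _ ≤ C * (ε / (3 * (C + 1))) := by gcongr
      _ < (C + 1) * (ε / (3 * (C + 1))) := by gcongr; linarith
      _ = ε / 3 := by field_simp
  obtain ⟨N, hN⟩ := Metric.cauchySeq_iff'.1 (hspan y hy) (ε / 3) (by positivity)
  refine ⟨N, fun n hn => ?_⟩
  calc dist (u n x) (u N x)
      ≤ dist (u n x) (u n y) + dist (u N x) (u N y) + dist (u n y) (u N y) :=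
        dist_triangle4_right _ _ _ _
    _ < ε / 3 + ε / 3 + ε / 3 := add_lt_add (add_lt_add (hclose n) (hclose N)) (hN n hn)
    _ = ε := by ring

variable {𝕜 E : Type*} [RCLike 𝕜] [NormedAddCommGroup E] [InnerProductSpace 𝕜 E] [CompleteSpace E]

lemma exists_tendsto_inner_of_converges {u : ℕ → E}
    (h : ∀ y, Converges fun n => ⟪u n, y⟫_𝕜) :
    ∃ z, ∀ y, Tendsto (fun n => ⟪u n, y⟫_𝕜) atTop (𝓝 ⟪z, y⟫_𝕜) := by
  choose f hf using h
  let F : E →L[𝕜] 𝕜 := continuousLinearMapOfTendsto (fun n => innerSL 𝕜 (u n)) (f := f)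
    (tendsto_pi_nhds.2 hf)
  refine ⟨(InnerProductSpace.toDual 𝕜 E).symm F, fun y => ?_⟩
  rw [InnerProductSpace.toDual_symm_apply]
  exact hf y

lemma exists_tendsto_wot_of_converges_inner {A : ℕ → E →L[𝕜] E} {C : ℝ} (hA : ∀ n, ‖A n‖ ≤ C)
    (h : ∀ x y, Converges fun n => ⟪A n x, y⟫_𝕜) :
    ∃ T : E →L[𝕜] E, Tendsto (fun n => ContinuousLinearMapWOT.ofCLM (A n)) atTop
      (𝓝 (ContinuousLinearMapWOT.ofCLM T)) := by
  choose T hT using fun x => exists_tendsto_inner_of_converges (h x)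
  have hadd (x x' : E) : T (x + x') = T x + T x' := by
    refine ext_inner_right 𝕜 fun y => tendsto_nhds_unique (hT (x + x') y) ?_
    simpa only [map_add, inner_add_left] using (hT x y).add (hT x' y)
  have hsmul (c : 𝕜) (x : E) : T (c • x) = c • T x := by
    refine ext_inner_right 𝕜 fun y => tendsto_nhds_unique (hT (c • x) y) ?_
    simpa only [map_smul, inner_smul_left] using (hT x y).const_mul _
  have hbound (x : E) : ‖T x‖ ≤ C * ‖x‖ := by
    have hC : 0 ≤ C := (norm_nonneg _).trans (hA 0)
    rw [← innerSL_apply_norm 𝕜 (T x)]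
    refine ContinuousLinearMap.opNorm_le_bound _ (by positivity) fun y =>
      le_of_tendsto (hT x y).norm (Eventually.of_forall fun n => ?_)
    exact (norm_inner_le_norm _ _).trans (by gcongr; exact (A n).le_of_opNorm_le (hA n) x)
  refine ⟨LinearMap.mkContinuous ⟨⟨T, hadd⟩, hsmul⟩ C hbound, ?_⟩
  rw [ContinuousLinearMapWOT.tendsto_iff_forall_inner_apply_tendsto]
  intro x y
  have hconj := (RCLike.continuous_conj.tendsto _).comp (hT x y)
  simp only [Function.comp_def, inner_conj_symm] at hconj
  exact hconj

lemma exists_tendsto_wot_of_converges_inner_basis {ι : Type*} (b : HilbertBasis ι 𝕜 E)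
    {A : ℕ → E →L[𝕜] E} {C : ℝ} (hA : ∀ n, ‖A n‖ ≤ C)
    (h : ∀ i j, Converges fun n => ⟪b i, A n (b j)⟫_𝕜) :
    ∃ T : E →L[𝕜] E, Tendsto (fun n => ContinuousLinearMapWOT.ofCLM (A n)) atTop
      (𝓝 (ContinuousLinearMapWOT.ofCLM T)) := by
  have hright (i : ι) (x : E) : Converges fun n => ⟪b i, A n x⟫_𝕜 := by
    refine converges_apply_of_dense_span (u := fun n => innerSL 𝕜 (b i) ∘L A n) (C := C)
      (fun n => ?_) b.dense_span (Set.forall_mem_range.2 (h i)) x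
    calc ‖innerSL 𝕜 (b i) ∘L A n‖ ≤ ‖innerSL 𝕜 (b i)‖ * ‖A n‖ :=
          ContinuousLinearMap.opNorm_comp_le _ _
      _ = ‖A n‖ := by rw [innerSL_apply_norm, b.orthonormal.norm_eq_one, one_mul]
      _ ≤ C := hA n
  refine exists_tendsto_wot_of_converges_inner hA fun x => ?_
  refine converges_apply_of_dense_span (u := fun n => innerSL 𝕜 (A n x)) (C := C * ‖x‖)
    (fun n => ?_) b.dense_span (Set.forall_mem_range.2 fun i => ?_)
  · rw [innerSL_apply_norm]
    exact (A n).le_of_opNorm_le (hA n) x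
  · obtain ⟨a, ha⟩ := hright i x
    refine ⟨_, ((RCLike.continuous_conj.tendsto _).comp ha).congr fun n => ?_⟩
    exact inner_conj_symm _ _

end WeakConvergence

section WeaklyAsymptoticallyToeplitz

lemma inner_stdVec_left (i : ℕ) (x : EllTwo) : ⟪stdVec i, x⟫_ℂ = x i := by
  rw [stdVec, lp.inner_single_left]
  simp

lemma norm_stdVec (n : ℕ) : ‖stdVec n‖ = 1 := by
  rw [stdVec, lp.norm_single (by norm_num), norm_one]

lemma norm_entry_le (A : EllTwo →L[ℂ] EllTwo) (i j : ℕ) : ‖entry A i j‖ ≤ ‖A‖ :=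
  calc ‖entry A i j‖ ≤ ‖stdVec i‖ * ‖A (stdVec j)‖ := norm_inner_le_norm _ _
    _ ≤ ‖stdVec i‖ * (‖A‖ * ‖stdVec j‖) := by gcongr; exact A.le_opNorm _
    _ = ‖A‖ := by rw [norm_stdVec, norm_stdVec, one_mul, mul_one]

lemma shiftR_stdVec (n : ℕ) : shiftR (stdVec n) = stdVec (n + 1) := by
  ext i
  change shiftSeq (stdVec n) i = stdVec (n + 1) i
  rw [stdVec, stdVec, lp.coeFn_single, lp.coeFn_single]
  cases i with
  | zero => simp [shiftSeq]
  | succ i => simp [shiftSeq, Pi.single_apply]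

lemma shiftR_pow_stdVec (n j : ℕ) : (shiftR ^ n) (stdVec j) = stdVec (j + n) := by
  induction n with
  | zero => rfl
  | succ n ih => rw [pow_succ', mul_apply_eq_comp, ih, shiftR_stdVec, add_assoc]

lemma shiftL_pow_apply (n i : ℕ) (x : EllTwo) : (shiftL ^ n) x i = x (i + n) := by
  induction n generalizing i with
  | zero => rfl
  | succ n ih =>
    rw [pow_succ', mul_apply_eq_comp]
    change (shiftL ^ n) x (i + 1) = _
    rw [ih, add_right_comm, add_assoc]

lemma entry_shift (A : EllTwo →L[ℂ] EllTwo) (n i j : ℕ) :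
    entry ((shiftL ^ n) ∘L A ∘L (shiftR ^ n)) i j = entry A (i + n) (j + n) := by
  simp only [entry, inner_stdVec_left, ContinuousLinearMap.comp_apply, shiftR_pow_stdVec,
    shiftL_pow_apply]

lemma norm_shift_le (A : EllTwo →L[ℂ] EllTwo) (n : ℕ) :
    ‖(shiftL ^ n) ∘L A ∘L (shiftR ^ n)‖ ≤ ‖A‖ := by
  have := nontrivial_of_ne (stdVec 0) 0 (norm_pos_iff.1 (by rw [norm_stdVec]; exact one_pos))
  have hpow {S : EllTwo →L[ℂ] EllTwo} (hS : ‖S‖ ≤ 1) : ‖S ^ n‖ ≤ 1 :=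
    (norm_pow_le S n).trans (pow_le_one₀ (norm_nonneg S) hS)
  have hL := hpow (S := shiftL) (LinearMap.mkContinuous_norm_le _ zero_le_one _)
  have hR := hpow (S := shiftR) (LinearMap.mkContinuous_norm_le _ zero_le_one _)
  calc ‖(shiftL ^ n) ∘L A ∘L (shiftR ^ n)‖ ≤ ‖shiftL ^ n‖ * (‖A‖ * ‖shiftR ^ n‖) :=
        (ContinuousLinearMap.opNorm_comp_le _ _).trans
          (by gcongr; exact ContinuousLinearMap.opNorm_comp_le _ _)
    _ ≤ 1 * (‖A‖ * 1) := by gcongr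
    _ = ‖A‖ := by rw [one_mul, mul_one]

lemma tendsto_entry_of_tendsto_wot {A : ℕ → EllTwo →L[ℂ] EllTwo} {T : EllTwo →L[ℂ] EllTwo}
    (h : Tendsto (fun n => ContinuousLinearMapWOT.ofCLM (A n)) atTop
      (𝓝 (ContinuousLinearMapWOT.ofCLM T))) (i j : ℕ) :
    Tendsto (fun n => entry (A n) i j) atTop (𝓝 (entry T i j)) :=
  ContinuousLinearMapWOT.tendsto_iff_forall_inner_apply_tendsto.1 h (stdVec j) (stdVec i)

lemma exists_tendsto_wot_of_converges_entry {A : ℕ → EllTwo →L[ℂ] EllTwo} {C : ℝ}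
    (hA : ∀ n, ‖A n‖ ≤ C) (h : ∀ i j, Converges fun n => entry (A n) i j) :
    ∃ T : EllTwo →L[ℂ] EllTwo, Tendsto (fun n => ContinuousLinearMapWOT.ofCLM (A n)) atTop
      (𝓝 (ContinuousLinearMapWOT.ofCLM T)) := by
  let b : HilbertBasis ℕ ℂ EllTwo := HilbertBasis.ofRepr (LinearIsometryEquiv.refl ℂ EllTwo)
  have hb (i : ℕ) : b i = stdVec i := (b.repr_symm_single i).symm
  refine exists_tendsto_wot_of_converges_inner_basis b hA fun i j => ?_
  simp only [hb]
  exact h i j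

lemma diagonal_add {α : Type*} [Zero α] (m : ℕ → ℕ → α) {i j : ℕ} (hij : i ≤ j + 1) (n : ℕ) :
    diagonal m (j + 1 - i) (n + j) = m (i + n) (j + n) := by
  rw [diagonal, if_pos (by omega), show n + j + 1 - (j + 1 - i) = i + n by omega, add_comm n]

lemma exists_tendsto_entry_shift_of_converges_diagonal {A : EllTwo →L[ℂ] EllTwo}
    (hA : ∀ i j, j + 1 < i → entry A i j = 0) (h : ∀ k, Converges (diagonal (entry A) k)) :
    ∃ t : ℤ → ℂ, ∀ i j : ℕ,
      Tendsto (fun n => entry A (i + n) (j + n)) atTop (𝓝 (t ((j : ℤ) - i))) := by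
  choose a ha using h
  refine ⟨fun l => if -1 ≤ l then a (l + 1).toNat else 0, fun i j => ?_⟩
  beta_reduce
  obtain hij | hij := le_or_gt i (j + 1)
  · rw [if_pos (by omega), show ((j : ℤ) - i + 1).toNat = j + 1 - i by omega]
    exact ((tendsto_add_atTop_iff_nat j).2 (ha _)).congr (diagonal_add _ hij)
  · rw [if_neg (by omega)]
    exact tendsto_const_nhds.congr fun n => (hA _ _ (by omega)).symm

lemma isWeaklyAsymptoticallyToeplitz_iff {A : EllTwo →L[ℂ] EllTwo}
    (hA : ∀ i j, j + 1 < i → entry A i j = 0) :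
    IsWeaklyAsymptoticallyToeplitz A ↔ ∀ k, Converges (diagonal (entry A) k) := by
  refine ⟨fun ⟨T, _, hT⟩ k => ⟨entry T 1 k, ?_⟩, fun h => ?_⟩
  · refine (tendsto_add_atTop_iff_nat k).1 ((tendsto_entry_of_tendsto_wot hT 1 k).congr fun n => ?_)
    rw [entry_shift]
    exact (diagonal_add _ (by omega) n).symm
  · obtain ⟨t, ht⟩ := exists_tendsto_entry_shift_of_converges_diagonal hA h
    simp only [← entry_shift] at ht
    obtain ⟨T, hT⟩ := exists_tendsto_wot_of_converges_entry (norm_shift_le A)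
      fun i j => ⟨_, ht i j⟩
    exact ⟨T, ⟨t, fun i j =>
      tendsto_nhds_unique (tendsto_entry_of_tendsto_wot hT i j) (ht i j)⟩, hT⟩

end WeaklyAsymptoticallyToeplitz

section OrthonormalPolynomials

variable {μ : Measure ℂ} [IsFiniteMeasure μ] (hc : IsCompact μ.support)
  (hinf : μ.support.Infinite)

include hc hinf in
lemma kappa_pos (n : ℕ) : 0 < kappa μ n := by
  rw [kappa, ← norm_sq_polyLp hc, Real.sqrt_sq (norm_nonneg _), inv_pos, norm_pos_iff, ne_eq,
    (polyLp_injective hc hinf).eq_iff' (map_zero _)]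
  exact (monic_monicPoly μ n).1.ne_zero

include hc hinf in
lemma degree_orthoPoly (n : ℕ) : (orthoPoly μ n).degree = n := by
  rw [orthoPoly, degree_C_mul (Complex.ofReal_ne_zero.2 (kappa_pos hc hinf n).ne'),
    degree_eq_natDegree (monic_monicPoly μ n).1.ne_zero, (monic_monicPoly μ n).2]

/-- The orthonormal polynomials of `μ`, bundled with the fact that `φ_n` has degree `n`. -/
noncomputable def orthoSeq : Polynomial.Sequence ℂ := ⟨orthoPoly μ, degree_orthoPoly hc hinf⟩

lemma orthoSeq_apply (n : ℕ) : orthoSeq hc hinf n = orthoPoly μ n := rfl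

lemma entry_bergmanShift_eq_inner (i j : ℕ) : entry (bergmanShift hc hinf) i j =
    ⟪polyLp hc (orthoPoly μ i), polyLp hc (X * orthoPoly μ j)⟫_ℂ := by
  rw [entry_bergmanShift, inner_polyLp]
  simp only [eval_mul, eval_X]

lemma sum_inner_mul_orthoSeq {p : ℂ[X]} {n : ℕ} (hp : p.degree < n) :
    p = ∑ i ∈ Finset.range n,
      C ⟪polyLp hc (orthoPoly μ i), polyLp hc p⟫_ℂ * orthoSeq hc hinf i := by
  have hspan : p ∈ Submodule.span ℂ (orthoSeq hc hinf '' (Finset.range n : Set ℕ)) := by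
    have h := (orthoSeq hc hinf).span_degreeLT (m := n)
      fun i _ => (leadingCoeff_ne_zero.2 ((orthoSeq hc hinf).ne_zero i)).isUnit
    rw [Finset.coe_range]
    exact h ▸ mem_degreeLT.2 hp
  obtain ⟨c, rfl⟩ := (Submodule.mem_span_image_finset_iff_exists_fun' ℂ).1 hspan
  refine Finset.sum_congr rfl fun i hi => ?_
  simp only [map_sum, map_smul, orthoSeq_apply]
  rw [(orthonormal_orthoPoly hc hinf).inner_right_sum c hi, C_mul']

lemma solvesHessenberg_orthoSeq :
    SolvesHessenberg (entry (bergmanShift hc hinf)) (orthoSeq hc hinf) := by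
  intro n
  simp only [entry_bergmanShift_eq_inner]
  refine sum_inner_mul_orthoSeq hc hinf ?_
  rw [degree_mul, degree_X, Polynomial.Sequence.degree_eq, add_comm]
  exact_mod_cast Nat.lt_succ_self (n + 1)

lemma entry_bergmanShift_eq_zero {i j : ℕ} (hij : j + 1 < i) :
    entry (bergmanShift hc hinf) i j = 0 := by
  rw [entry_bergmanShift_eq_inner, ← orthoSeq_apply hc hinf j, solvesHessenberg_orthoSeq hc hinf j,
    map_sum, inner_sum]
  refine Finset.sum_eq_zero fun k hk => ?_
  have hk := Finset.mem_range.1 hk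
  rw [C_mul', map_smul, inner_smul_right, orthoSeq_apply,
    (orthonormal_orthoPoly hc hinf).2 (by omega), mul_zero]

lemma entry_bergmanShift_succ (n : ℕ) :
    entry (bergmanShift hc hinf) (n + 1) n = (kappa μ n / kappa μ (n + 1) : ℝ) := by
  have hlead (i : ℕ) : (orthoSeq hc hinf i).coeff i = kappa μ i := by
    rw [orthoSeq_apply, ← leadingCoeff_orthoPoly, leadingCoeff, ← orthoSeq_apply hc hinf,
      Polynomial.Sequence.natDegree_eq]
  have hcoeff := congrArg (coeff · (n + 1)) (solvesHessenberg_orthoSeq hc hinf n)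
  have hlower : ∑ i ∈ Finset.range (n + 1),
      entry (bergmanShift hc hinf) i n * (orthoSeq hc hinf i).coeff (n + 1) = 0 :=
    Finset.sum_eq_zero fun i hi => by
      rw [coeff_eq_zero_of_natDegree_lt, mul_zero]
      rw [Polynomial.Sequence.natDegree_eq]
      exact Finset.mem_range.1 hi
  simp only [coeff_X_mul, finsetSum_coeff, coeff_C_mul] at hcoeff
  rw [Finset.sum_range_succ, hlower, zero_add, hlead, hlead] at hcoeff
  rw [Complex.ofReal_div, hcoeff,
    mul_div_cancel_right₀ _ (Complex.ofReal_ne_zero.2 (kappa_pos hc hinf _).ne')]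

lemma norm_diagonal_zero_bergmanShift (n : ℕ) :
    ‖diagonal (entry (bergmanShift hc hinf)) 0 n‖ = kappa μ n / kappa μ (n + 1) := by
  rw [diagonal, if_pos (Nat.zero_le _), Nat.sub_zero, entry_bergmanShift_succ hc hinf,
    Complex.norm_of_nonneg (div_pos (kappa_pos hc hinf _) (kappa_pos hc hinf _)).le]

include hc hinf in
lemma ratioAt_infty_orthoPoly (n : ℕ) :
    ratioAt (orthoPoly μ n) (orthoPoly μ (n + 1)) OnePoint.infty = 0 := by
  refine ratioAt_infty ?_
  rw [degree_orthoPoly hc hinf, degree_orthoPoly hc hinf]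
  exact_mod_cast n.lt_succ_self

lemma hasRatioAsymptotics_of_converges_coeff_ratioSeries
    (h : ∀ j, Converges fun n => PowerSeries.coeff j (ratioSeries (orthoSeq hc hinf) n)) :
    HasRatioAsymptotics μ := by
  have hM := norm_entry_le (bergmanShift hc hinf)
  have hB := (solvesHessenberg_orthoSeq hc hinf).bound_pos hM
  obtain ⟨g, hg, hlim⟩ :=
    (solvesHessenberg_orthoSeq hc hinf).exists_analyticOnNhd_tendsto_chartRatio hM h
  have hinv {z : ℂ} (hz : 4 * ‖bergmanShift hc hinf‖ < ‖z‖) :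
      z ≠ 0 ∧ z⁻¹ ∈ Metric.ball 0 (4 * ‖bergmanShift hc hinf‖)⁻¹ := by
    rw [mem_ball_zero_iff, norm_inv]
    exact ⟨norm_pos_iff.1 (by linarith), by gcongr⟩
  have hg0 : g 0 = 0 := by
    refine tendsto_nhds_unique (hlim 0 (Metric.mem_ball_self (by positivity))) ?_
    simp only [chartRatio_zero, tendsto_const_nhds]
  refine ⟨4 * ‖bergmanShift hc hinf‖, by positivity, fun z => z.elim 0 fun z => g z⁻¹,
    ⟨fun z hz => ?_, ?_⟩, ?_⟩
  · exact (hg _ (hinv hz).2).comp (analyticAt_inv (hinv hz).1)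
  · convert hg 0 (Metric.mem_ball_self (by positivity)) using 2 with w
    split_ifs with hw
    · rw [hw, hg0]; rfl
    · exact congrArg g (inv_inv w)
  · rintro z (rfl | ⟨z, hz, rfl⟩)
    · simp only [ratioAt_infty_orthoPoly hc hinf]
      exact tendsto_const_nhds
    · refine (hlim _ (hinv hz).2).congr fun n => ?_
      rw [chartRatio_eq_eval_inv n (inv_ne_zero (hinv hz).1), inv_inv]
      rfl

lemma hasRatioAsymptotics_iff : HasRatioAsymptotics μ ↔
    ∀ j, Converges fun n => PowerSeries.coeff j (ratioSeries (orthoSeq hc hinf) n) := by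
  refine ⟨fun ⟨R, _, f, _, hf⟩ => ?_, hasRatioAsymptotics_of_converges_coeff_ratioSeries hc hinf⟩
  exact (solvesHessenberg_orthoSeq hc hinf).converges_coeff_ratioSeries_of_eval
    (norm_entry_le (bergmanShift hc hinf)) fun z hz => ⟨f z, hf z (Or.inr ⟨z, hz, rfl⟩)⟩

end OrthonormalPolynomials

end OrthPoly

theorem corollary1p3_general (μ : Measure ℂ) [IsFiniteMeasure μ]
    (hc : IsCompact μ.support) (hinf : μ.support.Infinite)
    (hκ : ¬ Tendsto (fun n : ℕ => kappa μ n / kappa μ (n + 1)) atTop (𝓝 0)) :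
    HasRatioAsymptotics μ ↔ IsWeaklyAsymptoticallyToeplitz (bergmanShift hc hinf) := by
  rw [isWeaklyAsymptoticallyToeplitz_iff fun i j => entry_bergmanShift_eq_zero hc hinf,
    hasRatioAsymptotics_iff hc hinf]
  have hrec := (solvesHessenberg_orthoSeq hc hinf).solvesLongRecurrence
  refine ⟨fun hratio => ?_, fun hdiag => hrec.converges_coeff_of_converges hdiag⟩
  obtain ⟨a, ha⟩ := hratio 0
  simp only [hrec.coeff_zero] at ha
  have ha0 : a ≠ 0 := by
    rintro rfl
    exact hκ (by simpa only [norm_diagonal_zero_bergmanShift, norm_zero] using ha.norm)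
  exact hrec.converges_of_converges_coeff ha ha0 hratio

theorem corollary1p3 (μ : Measure ℂ) [IsFiniteMeasure μ]
    (hc : IsCompact μ.support) (hinf : μ.support.Infinite)
    (hκ : 0 < liminf (fun n : ℕ => kappa μ n / kappa μ (n + 1)) atTop) :
    HasRatioAsymptotics μ ↔ IsWeaklyAsymptoticallyToeplitz (bergmanShift hc hinf) :=
  corollary1p3_general μ hc hinf fun h => hκ.ne' h.liminf_eq
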